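/- **Proposition 2.3.** Let $G$ be an affine algebraic group over an algebraically closed field with a split $BN$-pair, i.e. $G$ has closed subgroups $B,N,U$ and, with $T=B\cap N$, the following hold: (i) $B\cup N$ generates $G$, $T$ is normal in $N$, and all elements of $T$ are semisimple; (ii) $W=N/T$ is generated by a set $S$ of elements of order $2$; (iii) if $n_i\in N$ maps to an element of $S$, then $n_iBn_i\neq B$; (iv) for such $n_i$ and every $n\in N$, $n_iBn\subseteq Bn_inB\cup BnB$; (v) $U$ is a closed unipotent normal subgroup of $B$ and $B=T\ltimes U$; (vi) $\bigcap_{n\in N}nBn^{-1}=T$. Then $W$ is finite. Let $k$ be any field, let $k_{tr}$ be the trivial one-dimensional $kB$-module with nonzero element $1_{tr}$, and let $M(tr)=kG\otimes_{kB}k_{tr}$; write $x1_{tr}$ for $x\otimes 1_{tr}$ $(x\in kG)$ and $w1_{tr}=n1_{tr}$ for $w=nT\in W$. For $J\subseteq S$ let $W_J$ be the subgroup of $W$ generated by $J$, and put $\eta_J=\sum_{w\in W_J}(-1)^{l(w)}w1_{tr}\in M(tr)$, where $l$ is the length function of $W$ with respect to $S$. Then: (a) For every $J\subseteq S$, the space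 $kUW\eta_J$, i.e. the $k$-span of all $un\eta_J$ with $u\in U$ and $n\in N$ (the vector $n\eta_J$ depends only on $nT\in W$), is a $G$-submodule of $M(tr)$. (b) In particular, for $J=S$, $kUW\eta_S=kU\eta_S=kU\sum_{w\in W}(-1)^{l(w)}w1_{tr}$ is a $G$-submodule of $M(tr)$ (called the Steinberg module $\mathrm{St}$). -/

import Mathlib

open scoped Pointwise

universe u v w

/-- The structure of an affine algebraic group over (the algebraically closed field) `F` on the
abstract group `G`: a finitely generated `F`-algebra of functions on `G` (the regular functions),
such that the points of `G` are exactly the `F`-algebra homomorphisms from it to `F`, and for which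
multiplication and inversion are morphisms of varieties. -/
structure AffineAlgebraicGroup (F : Type u) [Field F] (G : Type v) [Group G] where
  /-- The coordinate ring, as an algebra of functions. -/
  coord : Subalgebra F (G → F)
  fg : coord.FG
  eval_bijective : Function.Bijective
    (fun g : G => ((Pi.evalAlgHom F (fun _ : G => F) g).comp coord.val : coord →ₐ[F] F))
  comul : ∀ f ∈ coord, ∃ (m : ℕ) (a b : Fin m → G → F),
    (∀ i, a i ∈ coord) ∧ (∀ i, b i ∈ coord) ∧ ∀ x y, f (x * y) = ∑ i, a i x * b i y
  coinv : ∀ f ∈ coord, (fun x => f x⁻¹) ∈ coord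

namespace AffineAlgebraicGroup

variable {F : Type u} [Field F] {G : Type v} [Group G] (A : AffineAlgebraicGroup F G)

/-- Zariski closed subsets: common zero loci of regular functions. -/
def IsZariskiClosed (C : Set G) : Prop :=
  ∃ I : Set (G → F), I ⊆ A.coord ∧ C = {x | ∀ f ∈ I, f x = 0}

theorem translate_mem (g : G) {f : G → F} (hf : f ∈ A.coord) :
    (fun x => f (x * g)) ∈ A.coord := by
  obtain ⟨m, a, b, ha, -, h⟩ := A.comul f hf
  have : (fun x => f (x * g)) = ∑ i, b i g • a i := by
    funext x
    simp [h, mul_comm]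
  rw [this]
  exact Subalgebra.sum_mem _ fun i _ => A.coord.smul_mem (ha i) _

/-- Right translation `(ρ_g f)(x) = f (x g)` on the coordinate ring. -/
def rightTranslation (g : G) : Module.End F A.coord where
  toFun f := ⟨fun x => (f : G → F) (x * g), A.translate_mem g f.2⟩
  map_add' _ _ := rfl
  map_smul' _ _ := rfl

/-- `g` is semisimple: right translation by `g` is diagonalizable on the coordinate ring. As `F` is
algebraically closed and right translations are locally finite, this says that right translation is
semisimple on each finite-dimensional stable subspace. -/
def IsSemisimpleElement (g : G) : Prop :=
  ⨆ c : F, (A.rightTranslation g).eigenspace c = ⊤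

/-- `g` is unipotent: right translation by `g`, minus the identity, is locally nilpotent on the
coordinate ring. -/
def IsUnipotentElement (g : G) : Prop :=
  (A.rightTranslation g).maxGenEigenspace 1 = ⊤

end AffineAlgebraicGroup

/-- A split BN-pair of the affine algebraic group `G`. Throughout, `T = B ⊓ N`, and the group
`W = N / T` is realized as the quotient of `N` by `T`. -/
structure SplitBNPair {F : Type u} [Field F] {G : Type v} [Group G]
    (A : AffineAlgebraicGroup F G) where
  B : Subgroup G
  N : Subgroup G
  U : Subgroup G
  closed_B : A.IsZariskiClosed B
  closed_N : A.IsZariskiClosed N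
  /-- `B` and `N` generate `G`. -/
  generate : B ⊔ N = ⊤
  /-- `T` is normal in `N`. -/
  [normal_T : ((B ⊓ N).subgroupOf N).Normal]
  semisimple_T : ∀ t ∈ B ⊓ N, A.IsSemisimpleElement t
  /-- The generating set of `W`. -/
  S : Set (N ⧸ (B ⊓ N).subgroupOf N)
  closure_S : Subgroup.closure S = ⊤
  order_S : ∀ s ∈ S, orderOf s = 2
  /-- If `n ∈ N` represents an element of `S`, then `n B n ≠ B`. -/
  thick : ∀ n : N, (n : N ⧸ (B ⊓ N).subgroupOf N) ∈ S →
    ({(n : G)} * (B : Set G) * {(n : G)} : Set G) ≠ B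
  /-- If `n₁ ∈ N` represents an element of `S` and `n ∈ N`, then
  `n₁ B n ⊆ B n₁ n B ∪ B n B`. -/
  exchange : ∀ n₁ n : N, (n₁ : N ⧸ (B ⊓ N).subgroupOf N) ∈ S →
    ({(n₁ : G)} * (B : Set G) * {(n : G)} : Set G) ⊆
      (B : Set G) * {(n₁ : G) * (n : G)} * (B : Set G) ∪ (B : Set G) * {(n : G)} * (B : Set G)
  closed_U : A.IsZariskiClosed U
  unipotent_U : ∀ x ∈ U, A.IsUnipotentElement x
  U_le_B : U ≤ B
  /-- `U` is normal in `B`. -/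
  normal_U : (U.subgroupOf B).Normal
  /-- `B` is the semidirect product of `T` and `U`. -/
  T_inf_U : (B ⊓ N) ⊓ U = ⊥
  T_sup_U : (B ⊓ N) ⊔ U = B
  /-- The intersection of all `n B n⁻¹`, `n ∈ N`, is `T`. -/
  core : ⋂ n ∈ N, ({n} * (B : Set G) * {n⁻¹} : Set G) = ((B ⊓ N : Subgroup G) : Set G)

namespace SplitBNPair

variable {F : Type u} [Field F] {G : Type v} [Group G] {A : AffineAlgebraicGroup F G}
  (P : SplitBNPair A)

instance : ((P.B ⊓ P.N).subgroupOf P.N).Normal := P.normal_T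

/-- The group `W = N / T`. -/
abbrev W : Type v := P.N ⧸ (P.B ⊓ P.N).subgroupOf P.N

/-- The length of `w`: the least length of a word in `S` with product `w`. -/
noncomputable def length (w : P.W) : ℕ :=
  sInf {m | ∃ l : List P.W, (∀ s ∈ l, s ∈ P.S) ∧ l.length = m ∧ l.prod = w}

/-- `W_J`, the subgroup of `W` generated by `J`. -/
def parabolic (J : Set P.W) : Subgroup P.W := Subgroup.closure J

variable (k : Type w) [Field k]

/-- The underlying vector space of `M(tr)`, the representation of `G` induced from the trivial
one-dimensional representation `k_tr` of `B`. -/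
abbrev MtrSpace : Type (max v w) :=
  Representation.IndV P.B.subtype (Representation.trivial k P.B k)

/-- `M(tr)`, the representation of `G` over `k` induced from the trivial one-dimensional
representation of `B`. -/
noncomputable def Mtr : Representation k G (P.MtrSpace k) :=
  Representation.ind P.B.subtype (Representation.trivial k P.B k)

/-- The vector `1_tr`. -/
noncomputable def oneTr : P.MtrSpace k :=
  Representation.IndV.mk P.B.subtype (Representation.trivial k P.B k) 1 1

theorem Mtr_oneTr {b : G} (hb : b ∈ P.B) : P.Mtr k b (P.oneTr k) = P.oneTr k := by
  unfold Mtr oneTr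
  rw [Representation.ind_mk, one_mul]
  have h := Representation.Coinvariants.mk_self_apply
    (Representation.tprod ((Representation.leftRegular k G).comp P.B.subtype)
      (Representation.trivial k P.B k)) (⟨b, hb⟩⁻¹ : P.B)
    ((MonoidAlgebra.single (1 : G) (1 : k)) ⊗ₜ[k] (1 : k))
  simpa using h

/-- The vector `w 1_tr = n 1_tr` for `w = nT` in `W`. -/
noncomputable def weylVec : P.W → P.MtrSpace k :=
  Quotient.lift (fun n : P.N => P.Mtr k (n : G) (P.oneTr k)) (by
    intro a b hab
    have h : ((a⁻¹ * b : P.N) : G) ∈ P.B := by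
      have := QuotientGroup.leftRel_apply.mp hab
      exact (Subgroup.mem_subgroupOf.mp this).1
    have hb : (b : G) = a * ((a⁻¹ * b : P.N) : G) := by simp
    show P.Mtr k (a : G) (P.oneTr k) = P.Mtr k (b : G) (P.oneTr k)
    rw [hb, map_mul, Module.End.mul_apply, Mtr_oneTr P k h])

/-- The vector `∑ (-1)^{l(w)} w 1_tr`, the sum being over `w ∈ X` (a finite set in all uses). -/
noncomputable def altSum (X : Set P.W) : P.MtrSpace k :=
  ∑ᶠ w ∈ X, (-1 : k) ^ P.length w • P.weylVec k w

/-- `η_J = ∑_{w ∈ W_J} (-1)^{l(w)} w 1_tr`. -/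
noncomputable def eta (J : Set P.W) : P.MtrSpace k := P.altSum k (P.parabolic J)

/-- `kU m`, the span of all `u m` with `u ∈ U`. -/
noncomputable def spanU (m : P.MtrSpace k) : Submodule k (P.MtrSpace k) :=
  Submodule.span k {x | ∃ u ∈ P.U, x = P.Mtr k u m}

/-- `kUW η_J`, the span of all `u h η_J` with `u ∈ U` and `h = nT ∈ W`, where `h η_J` is `n η_J`
(this does not depend on the representative `n ∈ N` of `h`, since `T` is normal in `N` and fixes
`1_tr`). -/
noncomputable def spanUW (J : Set P.W) : Submodule k (P.MtrSpace k) :=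
  Submodule.span k {x | ∃ u ∈ P.U, ∃ n ∈ P.N, x = P.Mtr k u (P.Mtr k n (P.eta k J))}

end SplitBNPair

/-! The double cosets `BwB` are disjoint, and they yield the exchange condition: for `s` in `S`,
`BsB · BwB` lies in `BswB` exactly when `l(sw) > l(w)` (`ascends_iff`). The closed subgroups `B ∩
wBw⁻¹` shrink strictly as `w` is lengthened on the right (`fixer_mul_le`, `fixer_mul_ne`), so the
Noetherian coordinate ring forces an element `w₀` that every `s` shortens. Each element of `W` is
then a subword of a fixed word for `w₀`, and `W` is finite.

For the submodule statement, `B = TU` stabilizes `kUWη_J`, so only a representative `n` of `s` in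
`S` has to be treated. The group `K = B ∩ (sw₀)B(sw₀)⁻¹` serves as a rank one subgroup. It fixes
`w1_tr` whenever `l(sw) > l(w)` (`fixer_longest_le`), it satisfies `B = (B ∩ n⁻¹Bn)K`
(`exists_fixer_longest_factor`), and for `c` in `K` either `ncn⁻¹` lies in `B` or `ncn⁻¹ = c₁nc₂`
with `c₁, c₂` in `K` (`conj_fixer_longest`). This reduces the claim to `n c hη_J`. If `s` lengthens
all of `hW_J`, then `c` fixes `hη_J`; if it shortens all of it, `c₂` fixes `shη_J`. Otherwise `s`
maps `hW_J` to itself by a reflection, the terms pair off with opposite signs, and `n c hη_J =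
c₁hη_J - hη_J` (`Mtr_etaAt_of_reflection`). For `J = S`, `hη_S` is `±η_S`, so `W` can be dropped
from the span. -/

namespace SplitBNPair

variable {F : Type u} [Field F] {G : Type v} [Group G] {A : AffineAlgebraicGroup F G}
  (P : SplitBNPair A)

/-! ### Representatives of elements of the Weyl group -/

/-- The projection of `N` onto `W`. -/
def proj : P.N →* P.W := QuotientGroup.mk' _

theorem exists_rep (w : P.W) : ∃ n : P.N, P.proj n = w := QuotientGroup.mk'_surjective _ w

theorem mem_B_of_proj_eq {n n' : P.N} (h : P.proj n = P.proj n') : (n : G)⁻¹ * n' ∈ P.B := by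
  have := QuotientGroup.eq.mp h
  exact (Subgroup.mem_subgroupOf.mp this).1

theorem proj_eq_one_of_mem {n : P.N} (h : (n : G) ∈ P.B) : P.proj n = 1 :=
  (QuotientGroup.eq_one_iff n).mpr (Subgroup.mem_subgroupOf.mpr ⟨h, n.2⟩)

theorem mem_B_of_proj_eq_one {n : P.N} (h : P.proj n = 1) : (n : G) ∈ P.B := by
  simpa using P.mem_B_of_proj_eq (n := 1) (n' := n) (by simp [h])

variable {P}

theorem mul_self_of_mem {s : P.W} (hs : s ∈ P.S) : s * s = 1 := by
  rw [← pow_two, ← P.order_S s hs, pow_orderOf_eq_one]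

theorem inv_of_mem {s : P.W} (hs : s ∈ P.S) : s⁻¹ = s :=
  inv_eq_of_mul_eq_one_left (mul_self_of_mem hs)

theorem ne_one_of_mem {s : P.W} (hs : s ∈ P.S) : s ≠ 1 := by
  intro h
  have := P.order_S s hs
  simp [h] at this

theorem mul_cancel_of_mem {s : P.W} (hs : s ∈ P.S) (w : P.W) : s * (s * w) = w := by
  rw [← mul_assoc, mul_self_of_mem hs, one_mul]

/-! ### The length function -/

variable (P) in
theorem exists_word (w : P.W) : ∃ l : List P.W, (∀ s ∈ l, s ∈ P.S) ∧ l.prod = w := by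
  have hw : w ∈ Subgroup.closure P.S := by rw [P.closure_S]; trivial
  induction hw using Subgroup.closure_induction with
  | mem s hs => exact ⟨[s], by simpa using hs, by simp⟩
  | one => exact ⟨[], by simp, rfl⟩
  | mul x y _ _ hx hy =>
    obtain ⟨l, hl, rfl⟩ := hx
    obtain ⟨m, hm, rfl⟩ := hy
    refine ⟨l ++ m, fun s hs => ?_, by simp⟩
    exact (List.mem_append.mp hs).elim (hl s) (hm s)
  | inv x _ hx =>
    obtain ⟨l, hl, rfl⟩ := hx
    refine ⟨(l.map (·⁻¹)).reverse, fun s hs => ?_, (List.prod_inv_reverse l).symm⟩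
    simp only [List.mem_reverse, List.mem_map] at hs
    obtain ⟨t, ht, rfl⟩ := hs
    rw [inv_of_mem (hl t ht)]
    exact hl t ht

variable (P) in
theorem exists_reduced_word (w : P.W) :
    ∃ l : List P.W, (∀ s ∈ l, s ∈ P.S) ∧ l.length = P.length w ∧ l.prod = w := by
  obtain ⟨l, hl, hw⟩ := P.exists_word w
  exact Nat.sInf_mem (s := {m | ∃ l : List P.W, (∀ s ∈ l, s ∈ P.S) ∧ l.length = m ∧ l.prod = w})
    ⟨l.length, l, hl, rfl, hw⟩

theorem length_prod_le {l : List P.W} (hl : ∀ s ∈ l, s ∈ P.S) : P.length l.prod ≤ l.length :=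
  Nat.sInf_le ⟨l, hl, rfl, rfl⟩

theorem length_mul_le (x y : P.W) : P.length (x * y) ≤ P.length x + P.length y := by
  obtain ⟨l, hl, hl', rfl⟩ := P.exists_reduced_word x
  obtain ⟨m, hm, hm', rfl⟩ := P.exists_reduced_word y
  rw [← hl', ← hm', ← List.length_append, ← List.prod_append]
  exact length_prod_le fun s hs => (List.mem_append.mp hs).elim (hl s) (hm s)

theorem length_inv_le (x : P.W) : P.length x⁻¹ ≤ P.length x := by
  obtain ⟨l, hl, hl', rfl⟩ := P.exists_reduced_word x
  rw [← hl', List.prod_inv_reverse]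
  refine (length_prod_le fun s hs => ?_).trans (by simp)
  simp only [List.mem_reverse, List.mem_map] at hs
  obtain ⟨t, ht, rfl⟩ := hs
  rw [inv_of_mem (hl t ht)]
  exact hl t ht

theorem length_inv (x : P.W) : P.length x⁻¹ = P.length x :=
  (length_inv_le x).antisymm (by simpa using length_inv_le x⁻¹)

theorem length_one : P.length (1 : P.W) = 0 := by
  simpa using length_prod_le (P := P) (l := []) (by simp)

theorem eq_one_of_length {w : P.W} (h : P.length w = 0) : w = 1 := by
  obtain ⟨l, -, hl', rfl⟩ := P.exists_reduced_word w
  rw [h, List.length_eq_zero_iff] at hl'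
  simp [hl']

theorem length_le_one {s : P.W} (hs : s ∈ P.S) : P.length s ≤ 1 := by
  simpa using length_prod_le (P := P) (l := [s]) (by simpa using hs)

theorem mem_of_length_eq_one {w : P.W} (h : P.length w = 1) : w ∈ P.S := by
  obtain ⟨l, hl, hl', rfl⟩ := P.exists_reduced_word w
  rw [h, List.length_eq_one_iff] at hl'
  obtain ⟨s, rfl⟩ := hl'
  simpa using hl

theorem length_mul_le_succ {s : P.W} (hs : s ∈ P.S) (w : P.W) :
    P.length (s * w) ≤ P.length w + 1 := by
  have := length_mul_le s w
  have := length_le_one hs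
  omega

theorem length_le_mul_succ {s : P.W} (hs : s ∈ P.S) (w : P.W) :
    P.length w ≤ P.length (s * w) + 1 := by
  simpa [mul_cancel_of_mem hs] using length_mul_le_succ hs (s * w)

theorem exists_descent {w : P.W} {q : ℕ} (h : P.length w = q + 1) :
    ∃ s ∈ P.S, ∃ v, w = s * v ∧ P.length v = q := by
  obtain ⟨l, hl, hl', rfl⟩ := P.exists_reduced_word w
  rw [h] at hl'
  match l, hl, hl' with
  | s :: m, hl, hl' =>
    refine ⟨s, hl s (by simp), m.prod, by simp, ?_⟩
    have h1 : P.length m.prod ≤ m.length := length_prod_le fun t ht => hl t (by simp [ht])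
    have h2 := length_mul_le_succ (hl s (by simp)) m.prod
    simp only [List.length_cons, List.prod_cons] at hl' h
    omega

/-! ### Bruhat cells -/

variable (P) in
/-- The double coset `B w B`. -/
def cell (w : P.W) : Set G :=
  {g | ∃ n : P.N, P.proj n = w ∧ ∃ b ∈ P.B, ∃ b' ∈ P.B, g = b * n * b'}

theorem rep_mem_cell (n : P.N) : (n : G) ∈ P.cell (P.proj n) :=
  ⟨n, rfl, 1, P.B.one_mem, 1, P.B.one_mem, by simp⟩

theorem exists_of_mem_cell {n : P.N} {g : G} (h : g ∈ P.cell (P.proj n)) :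
    ∃ b ∈ P.B, ∃ b' ∈ P.B, g = b * n * b' := by
  obtain ⟨m, hm, b, hb, b', hb', rfl⟩ := h
  refine ⟨b, hb, _, P.B.mul_mem (P.mem_B_of_proj_eq hm.symm) hb', by group⟩

theorem mul_mem_cell {b g : G} {w : P.W} (hb : b ∈ P.B) (hg : g ∈ P.cell w) :
    b * g ∈ P.cell w := by
  obtain ⟨n, hn, c, hc, c', hc', rfl⟩ := hg
  exact ⟨n, hn, _, P.B.mul_mem hb hc, c', hc', by group⟩

theorem mem_cell_mul {b g : G} {w : P.W} (hg : g ∈ P.cell w) (hb : b ∈ P.B) :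
    g * b ∈ P.cell w := by
  obtain ⟨n, hn, c, hc, c', hc', rfl⟩ := hg
  exact ⟨n, hn, c, hc, _, P.B.mul_mem hc' hb, by group⟩

theorem inv_mem_cell {g : G} {w : P.W} (hg : g ∈ P.cell w) : g⁻¹ ∈ P.cell w⁻¹ := by
  obtain ⟨n, rfl, c, hc, c', hc', rfl⟩ := hg
  exact ⟨n⁻¹, by simp, _, P.B.inv_mem hc', _, P.B.inv_mem hc, by simp [mul_assoc]⟩

theorem mem_cell_one {g : G} : g ∈ P.cell 1 ↔ g ∈ P.B := by
  constructor
  · rintro ⟨n, hn, c, hc, c', hc', rfl⟩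
    exact P.B.mul_mem (P.B.mul_mem hc (P.mem_B_of_proj_eq_one hn)) hc'
  · intro h
    exact ⟨1, by simp, g, h, 1, P.B.one_mem, by simp⟩

theorem mul_mem_cell_or {s w : P.W} (hs : s ∈ P.S) {g h : G} (hg : g ∈ P.cell s)
    (hh : h ∈ P.cell w) : g * h ∈ P.cell (s * w) ∨ g * h ∈ P.cell w := by
  obtain ⟨n, rfl, b, hb, b', hb', rfl⟩ := hg
  obtain ⟨m, rfl, c, hc, c', hc', rfl⟩ := hh
  have hx : (n : G) * (b' * c) * m ∈ ({(n : G)} * (P.B : Set G) * {(m : G)} : Set G) :=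
    Set.mul_mem_mul (Set.mul_mem_mul rfl (P.B.mul_mem hb' hc)) rfl
  have key : b * n * b' * (c * m * c') = b * ((n : G) * (b' * c) * m) * c' := by group
  rw [key]
  refine (P.exchange n m hs hx).imp (fun h => ?_) (fun h => ?_)
  · obtain ⟨_, ⟨d, hd, _, rfl, rfl⟩, d', hd', h⟩ := h
    refine mem_cell_mul (mul_mem_cell hb ?_) hc'
    exact ⟨n * m, by simp, d, hd, d', hd', by simpa using h.symm⟩
  · obtain ⟨_, ⟨d, hd, _, rfl, rfl⟩, d', hd', h⟩ := h
    refine mem_cell_mul (mul_mem_cell hb ?_) hc'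
    exact ⟨m, rfl, d, hd, d', hd', by simpa using h.symm⟩

theorem mem_cell_mul_or {s w : P.W} (hs : s ∈ P.S) {g h : G} (hg : g ∈ P.cell w)
    (hh : h ∈ P.cell s) : g * h ∈ P.cell (w * s) ∨ g * h ∈ P.cell w := by
  have hh' := inv_mem_cell hh
  rw [inv_of_mem hs] at hh'
  refine (mul_mem_cell_or hs hh' (inv_mem_cell hg)).imp (fun h => ?_) (fun h => ?_)
  · simpa [inv_of_mem hs] using inv_mem_cell h
  · simpa using inv_mem_cell h

theorem cell_mul_self {s : P.W} (hs : s ∈ P.S) {g h : G} (hg : g ∈ P.cell s)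
    (hh : h ∈ P.cell s) : g * h ∈ P.B ∨ g * h ∈ P.cell s := by
  simpa [mul_self_of_mem hs, mem_cell_one] using mul_mem_cell_or hs hg hh

/-- Induction on the smaller length: stripping a left descent `s` from `w = sv` puts a
representative of `v` in `Bsw'B ∪ Bw'B`, and both lengths are still at least `l(v)`. -/
theorem cell_disjoint_aux (q : ℕ) : ∀ {w w' : P.W}, P.length w = q → q ≤ P.length w' →
    ∀ {g : G}, g ∈ P.cell w → g ∈ P.cell w' → w = w' := by
  induction q with
  | zero =>
    intro w w' hw _ g hg hg'
    have hw1 := eq_one_of_length hw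
    subst hw1
    rw [mem_cell_one] at hg
    obtain ⟨n, rfl, b, hb, b', hb', rfl⟩ := hg'
    refine (P.proj_eq_one_of_mem ?_).symm
    exact (P.B.mul_mem_cancel_left hb).mp ((P.B.mul_mem_cancel_right hb').mp hg)
  | succ q ih =>
    intro w w' hw hle g hg hg'
    obtain ⟨s, hs, v, rfl, hv⟩ := exists_descent hw
    obtain ⟨m, rfl⟩ := P.exists_rep v
    obtain ⟨n, rfl⟩ := P.exists_rep s
    rw [← map_mul] at hg
    obtain ⟨b, hb, b', hb', rfl⟩ := exists_of_mem_cell hg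
    have h1 : (n : G) * m ∈ P.cell w' := by
      have := mem_cell_mul (mul_mem_cell (P.B.inv_mem hb) hg') (P.B.inv_mem hb')
      simpa [mul_assoc] using this
    have hn : ((n⁻¹ : P.N) : G) ∈ P.cell (P.proj n) := by
      have := rep_mem_cell n⁻¹
      rwa [map_inv, inv_of_mem hs] at this
    have h2 := mul_mem_cell_or hs hn h1
    rw [InvMemClass.coe_inv, inv_mul_cancel_left] at h2
    have h3 := length_le_mul_succ hs w'
    rcases h2 with h2 | h2
    · rw [ih hv (by omega) (rep_mem_cell m) h2, mul_cancel_of_mem hs]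
    · have := ih hv (by omega) (rep_mem_cell m) h2
      rw [this] at hv
      omega

theorem cell_disjoint {w w' : P.W} {g : G} (hg : g ∈ P.cell w) (hg' : g ∈ P.cell w') :
    w = w' := by
  rcases le_total (P.length w) (P.length w') with h | h
  · exact cell_disjoint_aux _ rfl h hg hg'
  · exact (cell_disjoint_aux _ rfl h hg' hg).symm

/-- This is `thick` in usable form: if all products stayed in `B`, then both `nBn` and `n⁻¹Bn⁻¹`
would lie in `B`, forcing `nBn = B`. -/
theorem exists_mul_mem_cell {s : P.W} (hs : s ∈ P.S) :
    ∃ g ∈ P.cell s, ∃ h ∈ P.cell s, g * h ∈ P.cell s := by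
  by_contra! hcon
  obtain ⟨n, rfl⟩ := P.exists_rep s
  have hB : ∀ {g h : G}, g ∈ P.cell (P.proj n) → h ∈ P.cell (P.proj n) → g * h ∈ P.B :=
    fun hg hh => (cell_mul_self hs hg hh).resolve_right (hcon _ hg _ hh)
  have hn' : ((n : G))⁻¹ ∈ P.cell (P.proj n) := by
    have := inv_mem_cell (rep_mem_cell n)
    rwa [inv_of_mem hs] at this
  refine P.thick n hs (Set.Subset.antisymm ?_ fun b hb => ?_)
  · rintro _ ⟨_, ⟨_, rfl, b, hb, rfl⟩, _, rfl, rfl⟩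
    exact hB (mem_cell_mul (rep_mem_cell n) hb) (rep_mem_cell n)
  · have : (n : G)⁻¹ * b * (n : G)⁻¹ ∈ P.B := hB (mem_cell_mul hn' hb) hn'
    exact ⟨_, ⟨_, rfl, _, this, rfl⟩, _, rfl, by simp [mul_assoc]⟩

/-! ### The exchange condition -/

variable (P) in
/-- `BsB · BwB ⊆ BswB`. -/
def Ascends (s w : P.W) : Prop :=
  ∀ g ∈ P.cell s, ∀ h ∈ P.cell w, g * h ∈ P.cell (s * w)

theorem ascends_one {s : P.W} : P.Ascends s 1 := fun g hg h hh => by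
  rw [mul_one]
  exact mem_cell_mul hg (mem_cell_one.mp hh)

/-- Take `g`, `x`, `gx` all in `BsB`. Associating `gxn` in the two ways would put it in both `BwB`
and `BswB`. -/
theorem Ascends.not_mul {s w : P.W} (hs : s ∈ P.S) (h : P.Ascends s w) :
    ¬ P.Ascends s (s * w) := by
  intro h'
  obtain ⟨g, hg, x, hx, hgx⟩ := exists_mul_mem_cell hs
  obtain ⟨n, rfl⟩ := P.exists_rep w
  have h1 := h' g hg _ (h x hx _ (rep_mem_cell n))
  have h2 := h _ hgx _ (rep_mem_cell n)
  rw [mul_assoc] at h2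
  have := cell_disjoint h1 h2
  rw [mul_right_inj] at this
  exact ne_one_of_mem hs (by simpa using this)

/-- Folding: a product witnessing the failure at `wt` lies in `BwtB`. Multiplying from the left
first shows that it also lies in `BswB` or `BswtB`, and the latter is excluded by the failure. -/
theorem Ascends.mul_eq_mul {s t w : P.W} (hs : s ∈ P.S) (ht : t ∈ P.S) (h : P.Ascends s w)
    (h' : ¬ P.Ascends s (w * t)) : s * w = w * t := by
  unfold Ascends at h'
  push Not at h'
  obtain ⟨g, hg, x, hx, hgx⟩ := h'
  have hgx' := (mul_mem_cell_or hs hg hx).resolve_left hgx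
  obtain ⟨n, rfl⟩ := P.exists_rep w
  obtain ⟨m, rfl⟩ := P.exists_rep t
  rw [← map_mul] at hx
  obtain ⟨b, hb, b', hb', rfl⟩ := exists_of_mem_cell hx
  have h1 : g * (b * n) ∈ P.cell (s * P.proj n) := h g hg _ (mul_mem_cell hb (rep_mem_cell n))
  have h2 := mem_cell_mul_or ht h1 (mem_cell_mul (rep_mem_cell m) hb')
  have e : g * (b * n) * (m * b') = g * (b * ((n * m : P.N) : G) * b') := by
    simp [mul_assoc]
  rw [e] at h2
  refine cell_disjoint (h2.resolve_left ?_) hgx'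
  rwa [mul_assoc s]

/-- The exchange condition: along the prefixes of the word, the first letter at which ascent fails
is the one that folding deletes. -/
theorem Ascends.exists_sublist {s : P.W} (hs : s ∈ P.S) (l : List P.W) :
    ∀ {x : P.W}, (∀ t ∈ l, t ∈ P.S) → P.Ascends s x → ¬ P.Ascends s (x * l.prod) →
    ∃ m : List P.W, m.Sublist l ∧ m.length + 1 = l.length ∧ s * x * l.prod = x * m.prod := by
  induction l with
  | nil =>
    intro x _ h h'
    simp [h] at h'
  | cons t l ih =>
    intro x hl h h'
    by_cases hxt : P.Ascends s (x * t)
    · obtain ⟨m, hm, hlen, he⟩ := ih (x := x * t) (fun r hr => hl r (by simp [hr])) hxt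
        (by simpa [mul_assoc] using h')
      exact ⟨t :: m, hm.cons_cons t, by simp [hlen], by simpa [mul_assoc] using he⟩
    · have := h.mul_eq_mul hs (hl t (by simp)) hxt
      refine ⟨l, List.sublist_cons_self t l, rfl, ?_⟩
      rw [List.prod_cons, this, mul_assoc x t, ← mul_assoc t t, mul_self_of_mem (hl t (by simp)),
        one_mul]

theorem length_lt_of_not_ascends {s w : P.W} (hs : s ∈ P.S) (h : ¬ P.Ascends s w) :
    P.length (s * w) < P.length w := by
  obtain ⟨l, hl, hl', rfl⟩ := P.exists_reduced_word w
  obtain ⟨m, hm, hlen, he⟩ := Ascends.exists_sublist hs l hl ascends_one (by simpa using h)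
  rw [mul_one, one_mul] at he
  rw [he]
  have := length_prod_le fun t ht => hl t (hm.subset ht)
  omega

theorem ascends_iff {s w : P.W} (hs : s ∈ P.S) :
    P.Ascends s w ↔ P.length w < P.length (s * w) := by
  constructor
  · intro h
    simpa [mul_cancel_of_mem hs] using length_lt_of_not_ascends hs (h.not_mul hs)
  · intro h
    by_contra h'
    have := length_lt_of_not_ascends hs h'
    omega

theorem length_mul_of_ascends {s w : P.W} (hs : s ∈ P.S) (h : P.Ascends s w) :
    P.length (s * w) = P.length w + 1 := by
  have := (ascends_iff hs).mp h
  have := length_mul_le_succ hs w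
  omega

theorem length_mul_of_not_ascends {s w : P.W} (hs : s ∈ P.S) (h : ¬ P.Ascends s w) :
    P.length (s * w) + 1 = P.length w := by
  have := length_lt_of_not_ascends hs h
  have := length_le_mul_succ hs w
  omega

theorem mul_mem_cell_of_lt {s w : P.W} (hs : s ∈ P.S) (h : P.length w < P.length (w * s))
    {g x : G} (hg : g ∈ P.cell w) (hx : x ∈ P.cell s) : g * x ∈ P.cell (w * s) := by
  have h1 : P.Ascends s w⁻¹ := by
    rw [ascends_iff hs, length_inv, ← length_inv (s * w⁻¹)]
    simpa [inv_of_mem hs] using h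
  have hx' := inv_mem_cell hx
  rw [inv_of_mem hs] at hx'
  have := inv_mem_cell (h1 _ hx' _ (inv_mem_cell hg))
  simpa [inv_of_mem hs] using this

/-! ### Stabilizers of chambers in the standard apartment -/

/-- The elements of `B` fixing the chamber `v` act transitively on the chambers of the panel of
`v` and `vs` other than `v`, if `vs` is longer than `v`. -/
theorem exists_fixing_of_lt {n m : P.N} (hs : P.proj m ∈ P.S)
    (h : P.length (P.proj n) < P.length (P.proj n * P.proj m)) {b : G} (hb : b ∈ P.B) :
    ∃ c ∈ P.B, (n : G)⁻¹ * c * n ∈ P.B ∧ ((n : G) * b * m)⁻¹ * c * (n * m) ∈ P.B := by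
  have h1 : (n : G) * (b * m) ∈ P.cell (P.proj n * P.proj m) :=
    mul_mem_cell_of_lt hs h (rep_mem_cell n) (mul_mem_cell hb (rep_mem_cell m))
  rw [← map_mul] at h1
  obtain ⟨c, hc, d, hd, he⟩ := exists_of_mem_cell h1
  rw [Subgroup.coe_mul] at he
  have hm : (m : G)⁻¹ ∈ P.cell (P.proj m) := by
    have := inv_mem_cell (rep_mem_cell m)
    rwa [inv_of_mem hs] at this
  refine ⟨c, hc, ?_, ?_⟩
  · have h2 : (n : G)⁻¹ * c * n = (b * m) * (d⁻¹ * (m : G)⁻¹) := by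
      have : c = (n : G) * (b * m) * d⁻¹ * ((n : G) * m)⁻¹ := by rw [he]; group
      rw [this]; group
    have h3 := cell_mul_self hs (mul_mem_cell hb (rep_mem_cell m))
      (mul_mem_cell (P.B.inv_mem hd) hm)
    rw [← h2] at h3
    refine h3.resolve_right fun h4 => ?_
    have h5 := mul_mem_cell_of_lt hs h (rep_mem_cell n) h4
    have h6 : (n : G) * ((n : G)⁻¹ * c * n) = c * n := by group
    rw [h6] at h5
    have := cell_disjoint (mul_mem_cell hc (rep_mem_cell n)) h5
    rw [← this] at h
    exact lt_irrefl _ h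
  · have : ((n : G) * b * m)⁻¹ * c * (n * m) = d⁻¹ := by
      rw [mul_assoc (n : G) b, he]; group
    rw [this]
    exact P.B.inv_mem hd

/-- Elements of `B` fixing `vs` also fix `v` if `vs` is longer than `v`. -/
theorem fixes_of_lt {n m : P.N} (hs : P.proj m ∈ P.S)
    (h : P.length (P.proj n) < P.length (P.proj n * P.proj m)) {c : G} (hc : c ∈ P.B)
    (hc' : ((n : G) * m)⁻¹ * c * (n * m) ∈ P.B) : (n : G)⁻¹ * c * n ∈ P.B := by
  have hm : (m : G)⁻¹ ∈ P.cell (P.proj m) := by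
    have := inv_mem_cell (rep_mem_cell m)
    rwa [inv_of_mem hs] at this
  have h3 := cell_mul_self hs (mem_cell_mul (rep_mem_cell m) hc') hm
  have h2 : (m : G) * (((n : G) * m)⁻¹ * c * (n * m)) * (m : G)⁻¹ = (n : G)⁻¹ * c * n := by group
  rw [h2] at h3
  refine h3.resolve_right fun h4 => ?_
  have h5 := mul_mem_cell_of_lt hs h (rep_mem_cell n) h4
  have h6 : (n : G) * ((n : G)⁻¹ * c * n) = c * n := by group
  rw [h6] at h5
  have := cell_disjoint (mul_mem_cell hc (rep_mem_cell n)) h5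
  rw [← this] at h
  exact lt_irrefl _ h

variable (P) in
/-- The stabilizer `w B w⁻¹` of the chamber `w`, intersected with `B`. -/
def fixer (w : P.W) : Subgroup G where
  carrier := {g | g ∈ P.B ∧ ∀ n : P.N, P.proj n = w → (n : G)⁻¹ * g * n ∈ P.B}
  one_mem' := ⟨P.B.one_mem, fun n _ => by simp⟩
  mul_mem' {a b} ha hb := ⟨P.B.mul_mem ha.1 hb.1, fun n hn => by
    have := P.B.mul_mem (ha.2 n hn) (hb.2 n hn)
    have e : (n : G)⁻¹ * (a * b) * n = (n : G)⁻¹ * a * n * ((n : G)⁻¹ * b * n) := by group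
    rwa [e]⟩
  inv_mem' {a} ha := ⟨P.B.inv_mem ha.1, fun n hn => by
    have := P.B.inv_mem (ha.2 n hn)
    have e : (n : G)⁻¹ * a⁻¹ * n = ((n : G)⁻¹ * a * n)⁻¹ := by group
    rwa [e]⟩

theorem mem_fixer {n : P.N} {g : G} :
    g ∈ P.fixer (P.proj n) ↔ g ∈ P.B ∧ (n : G)⁻¹ * g * n ∈ P.B := by
  refine ⟨fun h => ⟨h.1, h.2 n rfl⟩, fun h => ⟨h.1, fun m hm => ?_⟩⟩
  have h1 := P.mem_B_of_proj_eq hm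
  have e : (m : G)⁻¹ * g * m = (m : G)⁻¹ * n * ((n : G)⁻¹ * g * n) * ((m : G)⁻¹ * n)⁻¹ := by group
  rw [e]
  exact P.B.mul_mem (P.B.mul_mem h1 h.2) (P.B.inv_mem h1)

theorem fixer_mul_le {s w : P.W} (hs : s ∈ P.S) (h : P.length w < P.length (w * s)) :
    P.fixer (w * s) ≤ P.fixer w := by
  obtain ⟨n, rfl⟩ := P.exists_rep w
  obtain ⟨m, rfl⟩ := P.exists_rep s
  intro c hc
  rw [← map_mul, mem_fixer] at hc
  exact mem_fixer.mpr ⟨hc.1, fixes_of_lt hs h hc.1 (by simpa using hc.2)⟩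

/-- By thickness some `b` in `B` moves the chamber `s`. An element of `B` fixing `w` and carrying
`ws` to the chamber `nbmB` then does not fix `ws`. -/
theorem fixer_mul_ne {s w : P.W} (hs : s ∈ P.S) (h : P.length w < P.length (w * s)) :
    P.fixer (w * s) ≠ P.fixer w := by
  obtain ⟨n, rfl⟩ := P.exists_rep w
  obtain ⟨m, rfl⟩ := P.exists_rep s
  intro heq
  obtain ⟨g, hg, x, hx, hgx⟩ := exists_mul_mem_cell hs
  have hm : (m : G)⁻¹ ∈ P.cell (P.proj m) := by
    have := inv_mem_cell (rep_mem_cell m)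
    rwa [inv_of_mem hs] at this
  obtain ⟨b, hb, hbm⟩ : ∃ b ∈ P.B, (m : G)⁻¹ * b * m ∉ P.B := by
    by_contra! hcon
    rw [← inv_of_mem hs, ← map_inv] at hg
    obtain ⟨b1, hb1, b2, hb2, rfl⟩ := exists_of_mem_cell hg
    obtain ⟨b3, hb3, b4, hb4, rfl⟩ := exists_of_mem_cell hx
    have h1 : b1 * ((m : G)⁻¹ * (b2 * b3) * m) * b4 ∈ P.B :=
      P.B.mul_mem (P.B.mul_mem hb1 (hcon _ (P.B.mul_mem hb2 hb3))) hb4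
    have e : b1 * ((m⁻¹ : P.N) : G) * b2 * (b3 * m * b4)
        = b1 * ((m : G)⁻¹ * (b2 * b3) * m) * b4 := by
      rw [InvMemClass.coe_inv]; group
    rw [e] at hgx
    exact ne_one_of_mem hs (cell_disjoint hgx (mem_cell_one.mpr h1))
  obtain ⟨c, hc, hc1, hc2⟩ := exists_fixing_of_lt hs h hb
  have h1 : c ∈ P.fixer (P.proj n * P.proj m) := by rw [heq]; exact mem_fixer.mpr ⟨hc, hc1⟩
  rw [← map_mul, mem_fixer] at h1
  have h2 := P.B.mul_mem h1.2 (P.B.inv_mem hc2)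
  have e : ((n * m : P.N) : G)⁻¹ * c * (n * m : P.N) * (((n : G) * b * m)⁻¹ * c * (n * m))⁻¹
      = (m : G)⁻¹ * b * m := by
    rw [Subgroup.coe_mul]; group
  rw [e] at h2
  exact hbm h2

theorem fixer_mul_le_of_length (z : P.W) : ∀ {w : P.W},
    P.length (w * z) = P.length w + P.length z → P.fixer (w * z) ≤ P.fixer w := by
  induction hq : P.length z generalizing z with
  | zero =>
    intro w _
    rw [eq_one_of_length hq, mul_one]
  | succ q ih =>
    intro w hw
    obtain ⟨s, hs, y, rfl, hy⟩ := exists_descent hq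
    rw [← mul_assoc] at hw ⊢
    have h1 := length_mul_le (w * s) y
    have h2 := length_mul_le w s
    have h3 := length_le_one hs
    exact (ih y hy (by omega)).trans (fixer_mul_le hs (by omega))

end SplitBNPair

/-! ### Translations of regular functions and vanishing ideals -/

namespace AffineAlgebraicGroup

variable {F : Type u} [Field F] {G : Type v} [Group G] (A : AffineAlgebraicGroup F G)

theorem leftTranslate_mem (g : G) {f : G → F} (hf : f ∈ A.coord) :
    (fun x => f (g * x)) ∈ A.coord := by
  obtain ⟨m, a, b, -, hb, h⟩ := A.comul f hf
  have : (fun x => f (g * x)) = ∑ i, a i g • b i := by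
    funext x
    simp [h]
  rw [this]
  exact Subalgebra.sum_mem _ fun i _ => A.coord.smul_mem (hb i) _

/-- The ideal of regular functions vanishing on a set. -/
def vanishing (C : Set G) : Ideal A.coord where
  carrier := {f | ∀ x ∈ C, (f : G → F) x = 0}
  zero_mem' _ _ := rfl
  add_mem' {f g} hf hg x hx := by simp [hf x hx, hg x hx]
  smul_mem' c f hf x hx := by simp [hf x hx]

instance : IsNoetherianRing A.coord :=
  have : Algebra.FiniteType F A.coord := A.coord.fg_iff_finiteType.mp A.fg
  Algebra.FiniteType.isNoetherianRing F A.coord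

end AffineAlgebraicGroup

namespace SplitBNPair

variable {F : Type u} [Field F] {G : Type v} [Group G] {A : AffineAlgebraicGroup F G}
  {P : SplitBNPair A}

/-! ### Finiteness of the Weyl group -/

/-- The group is an intersection of `B` with a conjugate of `B`, hence Zariski closed; its vanishing
ideal therefore determines it. -/
theorem exists_regular_of_notMem_fixer {w : P.W} {g : G} (hg : g ∉ P.fixer w) :
    ∃ f ∈ A.vanishing (P.fixer w : Set G), (f : G → F) g ≠ 0 := by
  obtain ⟨I, hI, hB⟩ := P.closed_B
  have hBI : ∀ x, x ∈ P.B ↔ ∀ f ∈ I, f x = 0 := fun x => by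
    rw [← SetLike.mem_coe, hB]; rfl
  obtain ⟨n, rfl⟩ := P.exists_rep w
  by_cases h : g ∈ P.B
  · have h1 : (n : G)⁻¹ * g * n ∉ P.B := fun h' => hg (mem_fixer.mpr ⟨h, h'⟩)
    rw [hBI] at h1
    push Not at h1
    obtain ⟨f, hf, hfg⟩ := h1
    refine ⟨⟨fun x => f ((n : G)⁻¹ * x * n), ?_⟩, fun x hx => ?_, hfg⟩
    · exact A.leftTranslate_mem (n : G)⁻¹ (A.translate_mem (n : G) (hI hf))
    · exact (hBI _).mp (mem_fixer.mp hx).2 f hf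
  · rw [hBI] at h
    push Not at h
    obtain ⟨f, hf, hfg⟩ := h
    exact ⟨⟨f, hI hf⟩, fun x hx => (hBI _).mp hx.1 f hf, hfg⟩

variable (P) in
/-- The descending chain condition on closed subsets yields an element of `W` with every element of
`S` as a descent. -/
theorem exists_longest : ∃ w₀ : P.W, ∀ s ∈ P.S, ¬ P.Ascends s w₀ := by
  obtain ⟨_, ⟨w, rfl⟩, hw⟩ := (wellFounded_gt (α := Ideal A.coord)).has_min
    (Set.range fun w : P.W => A.vanishing (P.fixer w : Set G)) ⟨_, 1, rfl⟩
  -- The fixers shrink under right multiplication, whereas `Ascends` concerns left multiplication;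
  -- hence the inverse.
  refine ⟨w⁻¹, fun s hs has => ?_⟩
  rw [ascends_iff hs, length_inv, ← length_inv (s * w⁻¹), mul_inv_rev, inv_inv,
    inv_of_mem hs] at has
  refine hw _ ⟨w * s, rfl⟩ (lt_of_le_of_ne (fun f hf x hx => hf x (fixer_mul_le hs has hx)) ?_)
  intro heq
  refine fixer_mul_ne hs has ((fixer_mul_le hs has).antisymm fun x hx => ?_)
  by_contra hx'
  obtain ⟨f, hf, hfx⟩ := exists_regular_of_notMem_fixer hx'
  have heq' : A.vanishing (P.fixer w : Set G) = A.vanishing (P.fixer (w * s) : Set G) := heq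
  rw [← heq'] at hf
  exact hfx (hf x hx)

/-! ### The longest element and its rank one subgroups -/

section Longest

variable {w₀ : P.W} (hw₀ : ∀ s ∈ P.S, ¬ P.Ascends s w₀)
include hw₀

/-- Every element begins a reduced word for `w₀`: if `w₀ = xz` is reduced and `sx` is longer than
`x`, then, as `s` shortens `w₀`, the exchange deletes a letter of `z` and not of `x`. -/
theorem length_add_length_inv_mul (y : P.W) :
    P.length y + P.length (y⁻¹ * w₀) = P.length w₀ := by
  induction hq : P.length y generalizing y with
  | zero => simp [eq_one_of_length hq]
  | succ q ih =>
    obtain ⟨s, hs, x, rfl, hx⟩ := exists_descent hq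
    obtain ⟨l, hl, hl', hlx⟩ := P.exists_reduced_word (x⁻¹ * w₀)
    have h1 : P.Ascends s x := (ascends_iff hs).mpr (by omega)
    have h2 : x * l.prod = w₀ := by rw [hlx, mul_inv_cancel_left]
    obtain ⟨m, hm, hlen, he⟩ := h1.exists_sublist hs l hl (by rw [h2]; exact hw₀ s hs)
    have h3 : (s * x)⁻¹ * w₀ = m.prod := by
      rw [inv_mul_eq_iff_eq_mul, mul_assoc, ← he, mul_assoc, mul_cancel_of_mem hs, h2]
    have h4 := length_prod_le fun t ht => hl t (hm.subset ht)
    have h5 := length_mul_le (s * x) ((s * x)⁻¹ * w₀)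
    rw [mul_inv_cancel_left] at h5
    have h6 := ih x hx
    rw [h3] at h5 ⊢
    omega

theorem length_mul_longest (y : P.W) : P.length y + P.length (y * w₀) = P.length w₀ := by
  simpa [length_inv] using length_add_length_inv_mul hw₀ y⁻¹

/-- This bounds `W` by the finite set of subwords of a single word. -/
theorem exists_sublist_of_longest {l : List P.W} (hl : ∀ s ∈ l, s ∈ P.S) (hw : l.prod = w₀)
    (y : P.W) : ∃ m : List P.W, m.Sublist l ∧ m.prod = y * w₀ := by
  induction hq : P.length y generalizing y with
  | zero => exact ⟨l, List.Sublist.refl l, by simp [eq_one_of_length hq, hw]⟩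
  | succ q ih =>
    obtain ⟨s, hs, x, rfl, hx⟩ := exists_descent hq
    obtain ⟨m, hm, he⟩ := ih x hx
    have h1 := length_mul_longest hw₀ x
    have h2 := length_mul_longest hw₀ (s * x)
    have h3 : ¬ P.Ascends s (1 * m.prod) := by
      rw [one_mul, he, ascends_iff hs, ← mul_assoc]
      omega
    obtain ⟨m', hm', -, he'⟩ :=
      ascends_one.exists_sublist hs m (fun t ht => hl t (hm.subset ht)) h3
    refine ⟨m', hm'.trans hm, ?_⟩
    rw [mul_one, one_mul] at he'
    rw [← he', he, mul_assoc]

theorem length_longest_mul {s : P.W} (hs : s ∈ P.S) :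
    P.length (s * w₀) + 1 = P.length w₀ :=
  length_mul_of_not_ascends hs (hw₀ s hs)

/-- Since `sw` begins a reduced word for `w₀`, `w` begins one for `sw₀`, and fixers decrease along
reduced words. -/
theorem fixer_longest_le {s w : P.W} (hs : s ∈ P.S) (h : P.Ascends s w) :
    P.fixer (s * w₀) ≤ P.fixer w := by
  have h1 := length_longest_mul hw₀ hs
  have h2 := length_mul_of_ascends hs h
  have h3 := length_add_length_inv_mul hw₀ (s * w)
  rw [mul_inv_rev, inv_of_mem hs, mul_assoc] at h3
  have h4 : w * (w⁻¹ * (s * w₀)) = s * w₀ := mul_inv_cancel_left _ _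
  have h5 := fixer_mul_le_of_length (w⁻¹ * (s * w₀)) (w := w) (by rw [h4]; omega)
  rwa [h4] at h5

/-- `K` is transitive on the chambers `bnB`. This is `exists_fixing_of_lt` for the panel of
`(sw₀)⁻¹` and `w₀⁻¹`, conjugated back by a representative of `sw₀`. -/
theorem exists_mem_fixer_longest {n : P.N} (hs : P.proj n ∈ P.S) {b : G} (hb : b ∈ P.B) :
    ∃ c ∈ P.fixer (P.proj n * w₀), (b * n)⁻¹ * c * n ∈ P.B := by
  obtain ⟨m, hm⟩ := P.exists_rep (P.proj n * w₀)
  have h1 := length_longest_mul hw₀ hs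
  have h2 : P.proj m⁻¹ * P.proj n = w₀⁻¹ := by
    rw [map_inv, hm, mul_inv_rev, inv_mul_cancel_right]
  obtain ⟨c, hc, hc1, hc2⟩ := exists_fixing_of_lt (n := m⁻¹) (m := n) hs
    (by rw [h2, map_inv, length_inv, length_inv, hm]; omega) hb
  simp only [InvMemClass.coe_inv, inv_inv] at hc1 hc2
  refine ⟨m * c * (m : G)⁻¹, ?_, ?_⟩
  · rw [← hm, mem_fixer]
    refine ⟨hc1, ?_⟩
    have e : (m : G)⁻¹ * (m * c * (m : G)⁻¹) * m = c := by group
    rwa [e]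
  · have e : (b * n)⁻¹ * (m * c * (m : G)⁻¹) * n
        = ((m : G)⁻¹ * b * n)⁻¹ * c * ((m : G)⁻¹ * n) := by group
    rwa [e]

/-- Each element of `B` is the product of an element of `B ∩ n⁻¹Bn` and one fixing all chambers `w`
with `l(sw) > l(w)`. -/
theorem exists_fixer_longest_factor {n : P.N} (hs : P.proj n ∈ P.S) {b : G} (hb : b ∈ P.B) :
    ∃ c ∈ P.fixer (P.proj n * w₀), ∃ d ∈ P.B, (n : G) * d * (n : G)⁻¹ ∈ P.B ∧ b = d * c := by
  have hs' : P.proj n⁻¹ = P.proj n := by rw [map_inv, inv_of_mem hs]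
  obtain ⟨c, hc, h⟩ := exists_mem_fixer_longest hw₀ (n := n⁻¹) (by rwa [hs']) (P.B.inv_mem hb)
  rw [hs'] at hc
  refine ⟨c⁻¹, inv_mem hc, b * c, P.B.mul_mem hb hc.1, ?_, by group⟩
  simp only [InvMemClass.coe_inv, mul_inv_rev, inv_inv] at h
  simpa [mul_assoc] using h

/-- The rank one decomposition `L = K ∪ KsK`. -/
theorem conj_fixer_longest {n : P.N} (hs : P.proj n ∈ P.S) {c : G}
    (hc : c ∈ P.fixer (P.proj n * w₀)) (hc' : (n : G) * c * (n : G)⁻¹ ∉ P.B) :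
    ∃ c₁ ∈ P.fixer (P.proj n * w₀), ∃ c₂ ∈ P.fixer (P.proj n * w₀),
      (n : G) * c * (n : G)⁻¹ = c₁ * n * c₂ := by
  have hn : (n : G)⁻¹ ∈ P.cell (P.proj n) := by
    have := inv_mem_cell (rep_mem_cell n)
    rwa [inv_of_mem hs] at this
  have h1 := (cell_mul_self hs (mem_cell_mul (rep_mem_cell n) hc.1) hn).resolve_left hc'
  obtain ⟨b, hb, b', hb', he⟩ := exists_of_mem_cell h1
  obtain ⟨c₁, hc₁, h2⟩ := exists_mem_fixer_longest hw₀ hs hb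
  -- `c₁` is chosen with `c₁nB = bnB`, so the remaining factor lies in `B`; the work is to show that
  -- it fixes the chamber `sw₀` as well.
  refine ⟨c₁, hc₁, (n : G)⁻¹ * c₁⁻¹ * (n * c * (n : G)⁻¹), ?_, by group⟩
  obtain ⟨m, hm⟩ := P.exists_rep (P.proj n * w₀)
  rw [← hm, mem_fixer] at hc hc₁ ⊢
  have hB : (n : G)⁻¹ * c₁⁻¹ * (n * c * (n : G)⁻¹) ∈ P.B := by
    rw [he]
    have e : (n : G)⁻¹ * c₁⁻¹ * (b * n * b') = ((b * n)⁻¹ * c₁ * n)⁻¹ * b' := by group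
    rw [e]
    exact P.B.mul_mem (P.B.inv_mem h2) hb'
  refine ⟨hB, ?_⟩
  -- `z` represents `s' = w₀⁻¹ s w₀`
  set z : P.N := m⁻¹ * n⁻¹ * m with hz
  have hw : P.proj m * P.proj z = w₀ := by
    rw [hz, map_mul, map_mul, map_inv, map_inv, hm, inv_of_mem hs, mul_inv_rev,
      inv_of_mem hs]
    simp only [mul_assoc, mul_cancel_of_mem hs, mul_inv_cancel_left]
  have hlen := length_longest_mul hw₀ hs
  have hzS : P.proj z ∈ P.S := by
    have h3 := length_add_length_inv_mul hw₀ (P.proj m)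
    rw [← hw, inv_mul_cancel_left, hw, hm] at h3
    exact mem_of_length_eq_one (by omega)
  have hlt : P.length (P.proj m) < P.length (P.proj m * P.proj z) := by rw [hw, hm]; omega
  have hz' : ((z : G))⁻¹ ∈ P.cell (P.proj z) := by
    have := inv_mem_cell (rep_mem_cell z)
    rwa [inv_of_mem hzS] at this
  have e1 : (m : G)⁻¹ * ((n : G)⁻¹ * c₁⁻¹ * (n * c * (n : G)⁻¹)) * m
      = z * ((m : G)⁻¹ * c₁ * m)⁻¹ * (z : G)⁻¹ * ((m : G)⁻¹ * c * m * z) := by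
    simp only [hz, Subgroup.coe_mul, InvMemClass.coe_inv]
    group
  -- `B ∪ Bs'B` is closed under multiplication. The cell `Bs'B` is excluded afterwards, since it
  -- would move the chamber of `m` into `Bw₀B`.
  have hmem : (m : G)⁻¹ * ((n : G)⁻¹ * c₁⁻¹ * (n * c * (n : G)⁻¹)) * m ∈ P.B ∨
      (m : G)⁻¹ * ((n : G)⁻¹ * c₁⁻¹ * (n * c * (n : G)⁻¹)) * m ∈ P.cell (P.proj z) := by
    rw [e1]
    have h4 := mul_mem_cell hc.2 (rep_mem_cell z)
    rcases cell_mul_self hzS (mem_cell_mul (rep_mem_cell z) (P.B.inv_mem hc₁.2)) hz' with h | h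
    · exact Or.inr (mul_mem_cell h h4)
    · exact cell_mul_self hzS h h4
  refine hmem.resolve_right fun h4 => ?_
  have h5 := mul_mem_cell_of_lt hzS hlt (rep_mem_cell m) h4
  have h6 := mem_cell_mul (mul_mem_cell hB (rep_mem_cell m)) P.B.one_mem
  rw [mul_one] at h6
  have e2 : (m : G) * ((m : G)⁻¹ * ((n : G)⁻¹ * c₁⁻¹ * (n * c * (n : G)⁻¹)) * m)
      = (n : G)⁻¹ * c₁⁻¹ * (n * c * (n : G)⁻¹) * m := by
    rw [mul_assoc (m : G)⁻¹, mul_inv_cancel_left]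
  rw [e2] at h5
  rw [← cell_disjoint h6 h5] at hlt
  exact lt_irrefl _ hlt

end Longest

variable (P) in
theorem finite_W : Finite P.W := by
  obtain ⟨w₀, hw₀⟩ := P.exists_longest
  obtain ⟨l, hl, hlw⟩ := P.exists_word w₀
  have hfin : (List.prod '' {m : List P.W | m ∈ l.sublists}).Finite :=
    l.sublists.finite_toSet.image _
  refine Set.finite_univ_iff.mp (hfin.subset fun y _ => ?_)
  obtain ⟨m, hm, he⟩ := exists_sublist_of_longest hw₀ hl hlw (y * w₀⁻¹)
  exact ⟨m, List.mem_sublists.mpr hm, by simpa using he⟩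

end SplitBNPair

namespace SplitBNPair

variable {F : Type u} [Field F] {G : Type v} [Group G] {A : AffineAlgebraicGroup F G}
  {P : SplitBNPair A}

/-! ### The sign character -/

section Sign

variable (k : Type w) [Field k]

theorem sign_mul_of_mem {s : P.W} (hs : s ∈ P.S) (w : P.W) :
    (-1 : k) ^ P.length (s * w) = -(-1 : k) ^ P.length w := by
  by_cases h : P.Ascends s w
  · rw [length_mul_of_ascends hs h, pow_succ]
    ring
  · rw [← length_mul_of_not_ascends hs h, pow_succ]
    ring

theorem sign_mul (x y : P.W) :
    (-1 : k) ^ P.length (x * y) = (-1 : k) ^ P.length x * (-1 : k) ^ P.length y := by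
  induction hq : P.length x generalizing x with
  | zero => simp [eq_one_of_length hq]
  | succ q ih =>
    obtain ⟨s, hs, z, rfl, hz⟩ := exists_descent hq
    rw [mul_assoc, sign_mul_of_mem k hs, ih z hz, pow_succ]
    ring

theorem sign_conj {t : P.W} (ht : t ∈ P.S) (w : P.W) :
    (-1 : k) ^ P.length (w * t * w⁻¹) = -1 := by
  have h1 : (-1 : k) ^ P.length t = -1 := by
    simpa [length_one] using sign_mul_of_mem k ht 1
  rw [sign_mul, sign_mul, h1, length_inv, mul_assoc, neg_one_mul, mul_neg, ← mul_pow]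
  simp

end Sign

/-! ### Parabolic cosets -/

/-- If no such wall existed, folding would make ascent invariant under each right multiplication by
`J`, hence constant on the coset `hW_J`. -/
theorem exists_mul_eq_mul_of_mem_parabolic {J : Set P.W} (hJ : J ⊆ P.S) {s h x y : P.W}
    (hs : s ∈ P.S) (hx : x ∈ P.parabolic J) (hy : y ∈ P.parabolic J) (hsx : P.Ascends s (h * x))
    (hsy : ¬ P.Ascends s (h * y)) : ∃ w ∈ P.parabolic J, ∃ t ∈ J, s * (h * w) = h * w * t := by
  by_contra! hcon
  have step : ∀ w ∈ P.parabolic J, ∀ t ∈ J, P.Ascends s (h * w) → P.Ascends s (h * (w * t)) := by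
    intro w hw t ht hasc
    by_contra hn
    rw [← mul_assoc] at hn
    exact hcon w hw t ht (hasc.mul_eq_mul hs (hJ ht) hn)
  have key : ∀ z ∈ P.parabolic J, ∀ w ∈ P.parabolic J,
      (P.Ascends s (h * w) ↔ P.Ascends s (h * (w * z))) := by
    intro z hz
    unfold parabolic at hz
    induction hz using Subgroup.closure_induction with
    | mem t ht =>
      intro w hw
      refine ⟨step w hw t ht, fun h' => ?_⟩
      have := step (w * t) (mul_mem hw (Subgroup.subset_closure ht)) t ht h'
      rwa [mul_assoc w, mul_self_of_mem (hJ ht), mul_one] at this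
    | one => simp
    | mul a b ha hb iha ihb =>
      intro w hw
      rw [iha w hw, ihb (w * a) (mul_mem hw ha), mul_assoc w]
    | inv a ha iha =>
      intro w hw
      rw [iha (w * a⁻¹) (mul_mem hw (inv_mem ha)), inv_mul_cancel_right]
  have := (key (x⁻¹ * y) (mul_mem (inv_mem hx) hy) x hx).mp hsx
  rw [mul_inv_cancel_left] at this
  exact hsy this

/-! ### The permutation module -/

section Module

variable (k : Type w) [Field k]

theorem Mtr_mul_apply (g h : G) (x : P.MtrSpace k) :
    P.Mtr k (g * h) x = P.Mtr k g (P.Mtr k h x) := by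
  rw [map_mul, Module.End.mul_apply]

theorem Mtr_weylVec (n : P.N) (w : P.W) :
    P.Mtr k (n : G) (P.weylVec k w) = P.weylVec k (P.proj n * w) := by
  obtain ⟨m, rfl⟩ := P.exists_rep w
  rw [← map_mul]
  change P.Mtr k (n : G) (P.Mtr k (m : G) (P.oneTr k)) = P.Mtr k ((n * m : P.N) : G) (P.oneTr k)
  rw [Subgroup.coe_mul, Mtr_mul_apply]

theorem Mtr_weylVec_of_mem_fixer {w : P.W} {c : G} (hc : c ∈ P.fixer w) :
    P.Mtr k c (P.weylVec k w) = P.weylVec k w := by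
  obtain ⟨m, rfl⟩ := P.exists_rep w
  change P.Mtr k c (P.Mtr k (m : G) (P.oneTr k)) = P.Mtr k (m : G) (P.oneTr k)
  have e : c * m = m * ((m : G)⁻¹ * c * m) := by group
  rw [← Mtr_mul_apply, e, Mtr_mul_apply, Mtr_oneTr P k (mem_fixer.mp hc).2]

/-- The vector `h η_J`. -/
noncomputable def etaAt (J : Set P.W) (h : P.W) : P.MtrSpace k :=
  have := P.finite_W
  ∑ w ∈ (Set.toFinite (P.parabolic J : Set P.W)).toFinset,
    (-1 : k) ^ P.length w • P.weylVec k (h * w)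

theorem Mtr_etaAt (J : Set P.W) (n : P.N) (h : P.W) :
    P.Mtr k (n : G) (etaAt k J h) = etaAt k J (P.proj n * h) := by
  simp only [etaAt, map_sum, map_smul, Mtr_weylVec, mul_assoc]

theorem etaAt_one (J : Set P.W) : etaAt k J 1 = P.eta k J := by
  have := P.finite_W
  simp only [etaAt, eta, altSum, one_mul]
  exact (finsum_mem_eq_finite_toFinset_sum _ _).symm

theorem Mtr_eta (J : Set P.W) (n : P.N) :
    P.Mtr k (n : G) (P.eta k J) = etaAt k J (P.proj n) := by
  rw [← etaAt_one, Mtr_etaAt, mul_one]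

theorem etaAt_of_mem {J : Set P.W} {h : P.W} (hh : h ∈ P.parabolic J) :
    etaAt k J h = (-1 : k) ^ P.length h • P.eta k J := by
  have := P.finite_W
  rw [← etaAt_one]
  simp only [etaAt, Finset.smul_sum, one_mul]
  refine Finset.sum_bij (fun w _ => h * w) (fun w hw => ?_) (fun a _ b _ hab => ?_)
    (fun b hb => ?_) (fun w _ => ?_)
  · simp only [Set.Finite.mem_toFinset, SetLike.mem_coe] at hw ⊢
    exact mul_mem hh hw
  · exact mul_left_cancel hab
  · simp only [Set.Finite.mem_toFinset, SetLike.mem_coe] at hb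
    exact ⟨h⁻¹ * b, by simpa using mul_mem (inv_mem hh) hb, mul_inv_cancel_left _ _⟩
  · rw [sign_mul, smul_smul, ← mul_assoc, ← mul_pow]
    simp

theorem Mtr_etaAt_of_fixes {J : Set P.W} {h : P.W} {c : G}
    (hc : ∀ w ∈ P.parabolic J, c ∈ P.fixer (h * w)) :
    P.Mtr k c (etaAt k J h) = etaAt k J h := by
  simp only [etaAt, map_sum, map_smul]
  refine Finset.sum_congr rfl fun w hw => ?_
  simp only [Set.Finite.mem_toFinset, SetLike.mem_coe] at hw
  rw [Mtr_weylVec_of_mem_fixer k (hc w hw)]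

/-! ### The action of simple reflections on the vectors `h η_J` -/

section Longest

variable {w₀ : P.W} (hw₀ : ∀ s ∈ P.S, ¬ P.Ascends s w₀)
include hw₀

/-- Here `sh = hr` for the reflection `r = wtw⁻¹` in `W_J`, of sign `-1`. For `y = hx` with `sy`
longer, `K` fixes `y1_tr` and `nc = c₁nc₂n`, so `nc` sends `y1_tr - sy1_tr` to `sy1_tr - c₁sy1_tr`.
Both sides thus agree on each pair. -/
theorem Mtr_etaAt_of_reflection {J : Set P.W} (hJ : J ⊆ P.S) {n : P.N} (hs : P.proj n ∈ P.S)
    {c c₁ c₂ : G} (hc : c ∈ P.fixer (P.proj n * w₀)) (hc₁ : c₁ ∈ P.fixer (P.proj n * w₀))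
    (hc₂ : c₂ ∈ P.fixer (P.proj n * w₀)) (he : (n : G) * c * (n : G)⁻¹ = c₁ * n * c₂)
    {h w t : P.W} (hw : w ∈ P.parabolic J) (ht : t ∈ J)
    (hst : P.proj n * (h * w) = h * w * t) :
    P.Mtr k n (P.Mtr k c (etaAt k J h)) = P.Mtr k c₁ (etaAt k J h) - etaAt k J h := by
  have := P.finite_W
  set s := P.proj n with hsdef
  set r := w * t * w⁻¹ with hr
  have hrJ : r ∈ P.parabolic J := mul_mem (mul_mem hw (Subgroup.subset_closure ht)) (inv_mem hw)
  have hrr : r * r = 1 := by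
    have e : r * r = w * (t * t) * w⁻¹ := by rw [hr]; group
    rw [e, mul_self_of_mem (hJ ht)]
    group
  have hr1 : r ≠ 1 := by
    intro h1
    rw [hr, mul_inv_eq_one, mul_eq_left] at h1
    exact ne_one_of_mem (hJ ht) h1
  have hrx : ∀ x, h * (r * x) = s * (h * x) := by
    intro x
    have e : h * (r * x) = h * w * t * (w⁻¹ * x) := by rw [hr]; group
    rw [e, ← hst]
    group
  have hsign : ∀ x, (-1 : k) ^ P.length (r * x) = -(-1 : k) ^ P.length x := by
    intro x
    rw [sign_mul, hr, sign_conj k (hJ ht), neg_one_mul]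
  have hfix : ∀ {d x}, d ∈ P.fixer (s * w₀) → P.Ascends s x →
      P.Mtr k d (P.weylVec k x) = P.weylVec k x := fun hd hx =>
    Mtr_weylVec_of_mem_fixer k (fixer_longest_le hw₀ hs hx hd)
  have hpair : ∀ x, P.Ascends s x → P.Mtr k n (P.Mtr k c (P.weylVec k (s * x))) =
      P.Mtr k c₁ (P.weylVec k (s * x)) := by
    intro x hx
    have e : (n : G) * c = c₁ * n * c₂ * n := by rw [← he]; group
    rw [← Mtr_mul_apply, e, Mtr_mul_apply, Mtr_weylVec, ← hsdef, mul_cancel_of_mem hs,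
      Mtr_mul_apply, hfix hc₂ hx, Mtr_mul_apply, Mtr_weylVec]
  rw [← sub_eq_zero]
  simp only [etaAt, map_sum, map_smul, ← Finset.sum_sub_distrib, ← smul_sub]
  have hinv : ∀ x, P.Ascends s (h * x) →
      (-1 : k) ^ P.length x • (P.Mtr k n (P.Mtr k c (P.weylVec k (h * x))) -
        (P.Mtr k c₁ (P.weylVec k (h * x)) - P.weylVec k (h * x))) +
      (-1 : k) ^ P.length (r * x) • (P.Mtr k n (P.Mtr k c (P.weylVec k (h * (r * x)))) -
        (P.Mtr k c₁ (P.weylVec k (h * (r * x))) - P.weylVec k (h * (r * x)))) = 0 := by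
    intro x hx
    rw [hsign, hrx, hpair _ hx, hfix hc hx, hfix hc₁ hx, Mtr_weylVec, ← hsdef, neg_smul]
    abel_nf
  -- The pairing `x ↦ rx` has no fixed points, so the cancellation is valid in every characteristic.
  refine Finset.sum_involution (fun x _ => r * x) (fun x hx => ?_) (fun x _ _ => ?_)
    (fun x hx => ?_) (fun x _ => ?_)
  · by_cases hasc : P.Ascends s (h * x)
    · exact hinv x hasc
    · have hasc' : P.Ascends s (h * (r * x)) := by
        rw [hrx, ascends_iff hs, mul_cancel_of_mem hs]
        exact length_lt_of_not_ascends hs hasc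
      have := hinv (r * x) hasc'
      rw [← mul_assoc r r x, hrr, one_mul, add_comm] at this
      exact this
  · simpa using hr1
  · simp only [Set.Finite.mem_toFinset, SetLike.mem_coe] at hx ⊢
    exact mul_mem hrJ hx
  · rw [← mul_assoc, hrr, one_mul]

/-- A `B`-stable subspace containing all `h η_J` contains all `n b h η_J`, where `n` represents an
element of `S` and `b ∈ B`. -/
theorem Mtr_rep_mem {J : Set P.W} (hJ : J ⊆ P.S) {V : Submodule k (P.MtrSpace k)}
    (hV : ∀ b ∈ P.B, ∀ x ∈ V, P.Mtr k b x ∈ V) (hE : ∀ h, etaAt k J h ∈ V) {n : P.N}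
    (hs : P.proj n ∈ P.S) {b : G} (hb : b ∈ P.B) (h : P.W) :
    P.Mtr k n (P.Mtr k b (etaAt k J h)) ∈ V := by
  obtain ⟨c, hc, d, hd, hd', rfl⟩ := exists_fixer_longest_factor hw₀ hs hb
  suffices hmain : P.Mtr k n (P.Mtr k c (etaAt k J h)) ∈ V by
    have e : (n : G) * (d * c) = n * d * (n : G)⁻¹ * (n * c) := by group
    rw [← Mtr_mul_apply, e, Mtr_mul_apply, Mtr_mul_apply k (n : G) c]
    exact hV _ hd' _ hmain
  have e : (n : G) * c = n * c * (n : G)⁻¹ * n := by group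
  by_cases hcB : (n : G) * c * (n : G)⁻¹ ∈ P.B
  · rw [← Mtr_mul_apply, e, Mtr_mul_apply, Mtr_etaAt]
    exact hV _ hcB _ (hE _)
  obtain ⟨c₁, hc₁, c₂, hc₂, he⟩ := conj_fixer_longest hw₀ hs hc hcB
  by_cases hA : ∀ w ∈ P.parabolic J, P.Ascends (P.proj n) (h * w)
  · rw [Mtr_etaAt_of_fixes k fun w hw => fixer_longest_le hw₀ hs (hA w hw) hc, Mtr_etaAt]
    exact hE _
  -- When `s` shortens all of `hW_J`, it lengthens all of `shW_J`, so `c₂` fixes `shη_J` and the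
  -- result is `c₁hη_J`.
  by_cases hD : ∀ w ∈ P.parabolic J, ¬ P.Ascends (P.proj n) (h * w)
  · rw [← Mtr_mul_apply, e, he, Mtr_mul_apply, Mtr_etaAt, Mtr_mul_apply,
      Mtr_etaAt_of_fixes k fun w hw => fixer_longest_le hw₀ hs ?_ hc₂, Mtr_mul_apply, Mtr_etaAt,
      mul_cancel_of_mem hs]
    · exact hV _ hc₁.1 _ (hE _)
    · rw [ascends_iff hs, mul_assoc, mul_cancel_of_mem hs]
      exact length_lt_of_not_ascends hs (hD w hw)
  push Not at hA hD
  obtain ⟨y, hy, hsy⟩ := hA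
  obtain ⟨x, hx, hsx⟩ := hD
  obtain ⟨w, hw, t, ht, hst⟩ := exists_mul_eq_mul_of_mem_parabolic hJ hs hx hy hsx hsy
  rw [Mtr_etaAt_of_reflection k hw₀ hJ hs hc hc₁ hc₂ he hw ht hst]
  exact V.sub_mem (hV _ hc₁.1 _ (hE _)) (hE _)

end Longest

/-! ### Stabilizers of subspaces and conclusion -/

variable {k} in
/-- The subgroup of elements stabilizing a subspace. -/
def stab (V : Submodule k (P.MtrSpace k)) : Subgroup G where
  -- Stability under the inverse is imposed too, because no finite-dimensionality is available to
  -- deduce it.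
  carrier := {g | (∀ x ∈ V, P.Mtr k g x ∈ V) ∧ ∀ x ∈ V, P.Mtr k g⁻¹ x ∈ V}
  one_mem' := by simp
  mul_mem' {a b} ha hb := ⟨fun x hx => by
      rw [Mtr_mul_apply]
      exact ha.1 _ (hb.1 x hx), fun x hx => by
      rw [mul_inv_rev, Mtr_mul_apply]
      exact hb.2 _ (ha.2 x hx)⟩
  inv_mem' {a} ha := ⟨ha.2, by simpa using ha.1⟩

variable {k} in
theorem le_stab {V : Submodule k (P.MtrSpace k)} {H : Subgroup G}
    (h : ∀ g ∈ H, ∀ x ∈ V, P.Mtr k g x ∈ V) : H ≤ stab V :=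
  fun g hg => ⟨h g hg, h g⁻¹ (inv_mem hg)⟩

variable {k} in
theorem stab_eq_top {V : Submodule k (P.MtrSpace k)}
    (hB : ∀ b ∈ P.B, ∀ x ∈ V, P.Mtr k b x ∈ V)
    (hS : ∀ n : P.N, P.proj n ∈ P.S → ∀ x ∈ V, P.Mtr k n x ∈ V) : stab V = ⊤ := by
  have hBV : P.B ≤ stab V := le_stab hB
  refine top_le_iff.mp (P.generate ▸ sup_le hBV ?_)
  suffices key : ∀ w : P.W, w ∈ Subgroup.closure P.S → ∀ n : P.N, P.proj n = w →
      (n : G) ∈ stab V from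
    fun n hn => key (P.proj ⟨n, hn⟩) (by rw [P.closure_S]; trivial) ⟨n, hn⟩ rfl
  intro w hw
  induction hw using Subgroup.closure_induction with
  | mem s hs =>
    rintro n rfl
    exact ⟨hS n hs, hS n⁻¹ (by rwa [map_inv, inv_of_mem hs])⟩
  | one => exact fun n hn => hBV (P.mem_B_of_proj_eq_one hn)
  | mul x y _ _ hx hy =>
    intro n hn
    obtain ⟨m, rfl⟩ := P.exists_rep x
    have h1 := mul_mem (hx m rfl) (hy (m⁻¹ * n) (by rw [map_mul, map_inv, hn]; group))
    simpa using h1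
  | inv x _ hx =>
    intro n hn
    have := inv_mem (hx n⁻¹ (by rw [map_inv, hn, inv_inv]))
    simpa using this

theorem spanUW_eq (J : Set P.W) : P.spanUW k J =
    Submodule.span k {x | ∃ u ∈ P.U, ∃ h : P.W, x = P.Mtr k u (etaAt k J h)} := by
  unfold spanUW
  congr 1
  ext x
  constructor
  · rintro ⟨u, hu, n, hn, rfl⟩
    exact ⟨u, hu, _, by rw [← Mtr_eta k J ⟨n, hn⟩]⟩
  · rintro ⟨u, hu, h, rfl⟩
    obtain ⟨n, rfl⟩ := P.exists_rep h
    exact ⟨u, hu, n, n.2, by rw [Mtr_eta]⟩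

/-- `T` normalizes `U` and, lying in `N`, carries each `hη_J` to another such vector; `U` acts by
left multiplication. -/
theorem Mtr_mem_spanUW_of_mem_B (J : Set P.W) {b : G} (hb : b ∈ P.B) {x : P.MtrSpace k}
    (hx : x ∈ P.spanUW k J) : P.Mtr k b x ∈ P.spanUW k J := by
  suffices hle : P.B ≤ stab (P.spanUW k J) from (hle hb).1 x hx
  rw [spanUW_eq]
  refine P.T_sup_U.symm.le.trans (sup_le (le_stab fun t ht y hy => ?_)
    (le_stab fun u hu y hy => ?_))
  · induction hy using Submodule.span_induction with
    | mem y hy =>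
      obtain ⟨u, hu, h, rfl⟩ := hy
      have hu' : t * u * t⁻¹ ∈ P.U :=
        P.normal_U.conj_mem ⟨u, P.U_le_B hu⟩ hu ⟨t, ht.1⟩
      refine Submodule.subset_span ⟨_, hu', P.proj ⟨t, ht.2⟩ * h, ?_⟩
      rw [← Mtr_etaAt, ← Mtr_mul_apply, ← Mtr_mul_apply, inv_mul_cancel_right]
    | zero => simp
    | add y z _ _ hy hz => rw [map_add]; exact add_mem hy hz
    | smul a y _ hy => rw [map_smul]; exact Submodule.smul_mem _ a hy
  · induction hy using Submodule.span_induction with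
    | mem y hy =>
      obtain ⟨u', hu', h, rfl⟩ := hy
      exact Submodule.subset_span ⟨u * u', mul_mem hu hu', h, by rw [Mtr_mul_apply]⟩
    | zero => simp
    | add y z _ _ hy hz => rw [map_add]; exact add_mem hy hz
    | smul a y _ hy => rw [map_smul]; exact Submodule.smul_mem _ a hy

theorem spanUW_mem_invtSubmodule {J : Set P.W} (hJ : J ⊆ P.S) :
    P.spanUW k J ∈ (P.Mtr k).invtSubmodule := by
  obtain ⟨w₀, hw₀⟩ := P.exists_longest
  have hB : ∀ b ∈ P.B, ∀ x ∈ P.spanUW k J, P.Mtr k b x ∈ P.spanUW k J :=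
    fun b hb x hx => Mtr_mem_spanUW_of_mem_B k J hb hx
  have hE : ∀ h, etaAt k J h ∈ P.spanUW k J := fun h => by
    rw [spanUW_eq]
    exact Submodule.subset_span ⟨1, P.U.one_mem, h, by simp⟩
  have htop : stab (P.spanUW k J) = ⊤ := by
    refine stab_eq_top hB fun n hs x hx => ?_
    rw [spanUW_eq] at hx
    induction hx using Submodule.span_induction with
    | mem y hy =>
      obtain ⟨u, hu, h, rfl⟩ := hy
      exact Mtr_rep_mem k hw₀ hJ hB hE hs (P.U_le_B hu) h
    | zero => simp
    | add y z _ _ hy hz => rw [map_add]; exact add_mem hy hz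
    | smul a y _ hy => rw [map_smul]; exact Submodule.smul_mem _ a hy
  rw [Representation.mem_invtSubmodule]
  intro g x hx
  have hg : g ∈ stab (P.spanUW k J) := by rw [htop]; trivial
  exact hg.1 x hx

variable (P) in
theorem eta_S : P.eta k P.S = P.altSum k Set.univ := by
  rw [eta, parabolic, P.closure_S, Subgroup.coe_top]

variable (P) in
theorem spanUW_S : P.spanUW k P.S = P.spanU k (P.eta k P.S) := by
  rw [spanUW_eq]
  refine le_antisymm (Submodule.span_le.mpr ?_) (Submodule.span_mono ?_)
  · rintro _ ⟨u, hu, h, rfl⟩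
    have hh : h ∈ P.parabolic P.S := by
      rw [parabolic, P.closure_S]
      trivial
    rw [etaAt_of_mem k hh, map_smul]
    exact Submodule.smul_mem _ _ (Submodule.subset_span ⟨u, hu, rfl⟩)
  · rintro _ ⟨u, hu, rfl⟩
    exact ⟨u, hu, 1, by rw [etaAt_one]⟩

end Module

end SplitBNPair

theorem proposition2p3 {F : Type u} [Field F] [IsAlgClosed F] {G : Type v} [Group G]
    (A : AffineAlgebraicGroup F G) (P : SplitBNPair A) (k : Type w) [Field k] :
    Finite P.W ∧
    (∀ J : Set P.W, J ⊆ P.S → P.spanUW k J ∈ (P.Mtr k).invtSubmodule) ∧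
    P.spanUW k P.S = P.spanU k (P.eta k P.S) ∧
    P.spanU k (P.eta k P.S) = P.spanU k (P.altSum k Set.univ) ∧
    P.spanU k (P.altSum k Set.univ) ∈ (P.Mtr k).invtSubmodule := by
  refine ⟨P.finite_W, fun J hJ => SplitBNPair.spanUW_mem_invtSubmodule k hJ, P.spanUW_S k,
    by rw [P.eta_S], ?_⟩
  rw [← P.eta_S, ← P.spanUW_S]
  exact SplitBNPair.spanUW_mem_invtSubmodule k subset_rfl
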